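/- Fix a universe; $\mathbf{Ab}$ is the category of (small) abelian groups, and a category is *skeletally small* if it is equivalent to a small category. For an exact functor $F:\mathcal A\to\mathcal B$ between abelian categories let $\ker F=\{X\in\mathcal A: FX=0\}$, a Serre subcategory of $\mathcal A$, and for a Serre subcategory $\mathcal S\subseteq\mathcal A$ let $\mathcal A\to\mathcal A/\mathcal S$ be the exact localisation functor to the (abelian) quotient category; every exact $F:\mathcal A\to\mathcal B$ induces an exact functor $\mathcal A/\ker F\to\mathcal B$. A *free abelian category* on a skeletally small preadditive category $\mathcal R$ is a skeletally small abelian category $\mathrm{Ab}(\mathcal R)$ with a full and faithful additive functor $j:\mathcal R\to \mathrm{Ab}(\mathcal R)$ such that every additive functor from $\mathcal R$ to an abelian category $\mathcal D$ (with small morphism sets) extends along $j$ to an exact functor $\mathrm{Ab}(\mathcal R)\to\mathcal D$, and such that every isomorphism between the restrictions to $\mathcal R$ of two exact functors $\mathrm{Ab}(\mathcal R)\to\mathcal D$ extends to an isomorphism between these functors. 1. Every skeletally small preadditive category $\mathcal R$ has a free abelian category $j:\mathcal R\to\mathrm{Ab}(\mathcal R)$. 2. (From modules to exact functors.) Let $\mathcal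 R$ be a skeletally small preadditive category, $j:\mathcal R\to\mathrm{Ab}(\mathcal R)$ any free abelian category on $\mathcal R$, and $M:\mathcal R\to\mathbf{Ab}$ an additive functor. Then there is an exact functor $\widetilde M:\mathrm{Ab}(\mathcal R)\to\mathbf{Ab}$ with $\widetilde M j\cong M$, unique up to isomorphism. Put $\mathcal A(M)=\mathrm{Ab}(\mathcal R)/\ker\widetilde M$ and let $\widehat M:\mathcal A(M)\to\mathbf{Ab}$ be the exact functor induced by $\widetilde M$. The abelian category $\mathcal A(M)$ is skeletally small, the composition of $\mathrm{Ab}(\mathcal R)\to\mathcal A(M)$ with $\widehat M$ is isomorphic to $\widetilde M$, and $\widehat M$ is, up to isomorphism, the only exact functor on $\mathcal A(M)$ with this property. If $\mathcal A(M)'$ and $\widehat M'$ are obtained in the same way from another free abelian category on $\mathcal R$ and another exact extension of $M$, then there is an equivalence $\varphi:\mathcal A(M)\to\mathcal A(M)'$ with $\widehat M'\varphi\cong\widehat M$. 3. (From exact functors to modules, and back.) Let $\mathcal A$ be a skeletally small abelian category. Then there are a skeletally small preadditive category $\mathcal R$, a free abelian category $\mathrm{Ab}(\mathcal R)$ on it,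 and a Serre subcategory $\mathcal S$ of $\mathrm{Ab}(\mathcal R)$ with $\mathcal A\simeq\mathrm{Ab}(\mathcal R)/\mathcal S$. Moreover, let $G:\mathcal A\to\mathbf{Ab}$ be an exact functor, let $\mathrm{Ab}(\mathcal R)/\mathcal S\simeq\mathcal A$ be any such presentation of $\mathcal A$, and let $M:\mathcal R\to\mathbf{Ab}$ be (isomorphic to) the composition $\mathcal R\xrightarrow{j}\mathrm{Ab}(\mathcal R)\to\mathrm{Ab}(\mathcal R)/\mathcal S\simeq\mathcal A\xrightarrow{G}\mathbf{Ab}$, which is an additive functor. Let $G':\mathcal A/\ker G\to\mathbf{Ab}$ be the exact functor induced by $G$. Then there is an equivalence of categories $\theta:\mathcal A(M)\to\mathcal A/\ker G$ such that $G'\theta\cong\widehat M$ and such that the composition of $\theta$ with $\mathrm{Ab}(\mathcal R)\to\mathcal A(M)$ is isomorphic to the composition $\mathrm{Ab}(\mathcal R)\to\mathrm{Ab}(\mathcal R)/\mathcal S\simeq\mathcal A\to\mathcal A/\ker G$. -/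

import Mathlib

open CategoryTheory Limits

universe w v v' v'' v₁ v₂ v₃ u u' u'' u₁ u₂ u₃

namespace FreeAb

section FreeAbelian

variable {R : Type u} [Category.{v} R] [Preadditive R]
  {B : Type u'} [Category.{v'} B] [Abelian B]

/-- `IsFreeAbelian.{w} j` says that the additive functor `j : R ⥤+ B` exhibits the abelian category
`B` as the free abelian category (in the sense of Freyd) on the skeletally small preadditive
category `R`: `B` is skeletally small, `j` is a full embedding, and every additive functor from
`R` to an abelian category extends along `j` to an exact functor on `B`, which is unique up to
isomorphism, the isomorphism extending any given isomorphism of the restrictions to `R`.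

The target categories `D` have objects in `Type (w + 1)` and morphisms in `Type w`; up to
equivalence these include `AddCommGrpCat.{w}` and all `w`-essentially small abelian categories. -/
structure IsFreeAbelian (j : R ⥤+ B) : Prop where
  essentiallySmall : EssentiallySmall.{w} B
  full : j.obj.Full
  faithful : j.obj.Faithful
  exists_extension : ∀ (D : Type (w + 1)) [Category.{w} D] [Abelian D] (F : R ⥤+ D),
    ∃ E : B ⥤ₑ D, Nonempty (j.obj ⋙ E.obj ≅ F.obj)
  extension_unique : ∀ (D : Type (w + 1)) [Category.{w} D] [Abelian D] (E₁ E₂ : B ⥤ₑ D)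
    (α : j.obj ⋙ E₁.obj ≅ j.obj ⋙ E₂.obj),
    ∃ β : E₁.obj ≅ E₂.obj, Functor.isoWhiskerLeft j.obj β = α

end FreeAbelian

section SerreQuotient

variable {C : Type u₁} [Category.{v₁} C] [Abelian C]

/-- The quotient category `C/S` of an abelian category by a Serre subcategory `S`: the localization
of `C` at the morphisms whose kernel and cokernel lie in `S`. -/
abbrev SerreQuotient (S : ObjectProperty C) [S.IsSerreClass] : Type u₁ :=
  S.isoModSerre.Localization

noncomputable instance (S : ObjectProperty C) [S.IsSerreClass] : Abelian (SerreQuotient S) :=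
  ObjectProperty.SerreClassLocalization.abelian S.isoModSerre.Q S

/-- The localization functor `C ⥤ C/S`, which is exact. -/
noncomputable def quotientFunctor (S : ObjectProperty C) [S.IsSerreClass] :
    C ⥤ₑ SerreQuotient S :=
  ⟨S.isoModSerre.Q,
    ObjectProperty.SerreClassLocalization.preservesFiniteLimits S.isoModSerre.Q S,
    ObjectProperty.SerreClassLocalization.preservesFiniteColimits S.isoModSerre.Q S⟩

variable {D : Type u₂} [Category.{v₂} D] [Abelian D]

/-- The kernel of an exact functor `F`: the objects `X` such that `F X` is zero. -/
def ker (F : C ⥤ₑ D) : ObjectProperty C := fun X => IsZero (F.obj.obj X)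

instance (F : C ⥤ₑ D) : (ker F).IsSerreClass := by
  have := F.property.1
  have := F.property.2
  exact inferInstanceAs (ObjectProperty.inverseImage (IsZero (C := D)) F.obj).IsSerreClass

lemma ker_isInvertedBy (F : C ⥤ₑ D) : (ker F).isoModSerre.IsInvertedBy F.obj := by
  have : PreservesFiniteLimits F.obj := F.property.1
  have : PreservesFiniteColimits F.obj := F.property.2
  rw [ObjectProperty.isoModSerre_isInvertedBy_iff]
  exact fun X hX => hX

/-- The exact functor `C/ker(F) ⥤ D` induced by an exact functor `F : C ⥤ D`. -/
noncomputable def induced (F : C ⥤ₑ D) : SerreQuotient (ker F) ⥤ₑ D :=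
  ⟨Localization.lift F.obj (ker_isInvertedBy F) (ker F).isoModSerre.Q, by
    rw [← ObjectProperty.SerreClassLocalization.exactFunctor_comp_iff
      (ker F).isoModSerre.Q (ker F)]
    exact ObjectProperty.prop_of_iso _
      (Localization.fac F.obj (ker_isInvertedBy F) (ker F).isoModSerre.Q).symm F.property⟩

end SerreQuotient

section Restriction

variable {R : Type u} [Category.{v} R] [Preadditive R]
  {B : Type u'} [Category.{v'} B] [Abelian B]
  {A : Type u₁} [Category.{v₁} A] [Abelian A]
  {D : Type u₂} [Category.{v₂} D] [Abelian D]

/-- Given an equivalence `e : B/S ≌ A` and an exact functor `G : A ⥤ D`, the exact functor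
`B ⥤ B/S ≌ A ⥤ D`. -/
noncomputable def composite {S : ObjectProperty B} [S.IsSerreClass]
    (e : SerreQuotient S ≌ A) (G : A ⥤ₑ D) : B ⥤ₑ D :=
  ⟨(quotientFunctor S).obj ⋙ e.functor ⋙ G.obj, by
    have : PreservesFiniteLimits (quotientFunctor S).obj := (quotientFunctor S).property.1
    have : PreservesFiniteColimits (quotientFunctor S).obj := (quotientFunctor S).property.2
    have : PreservesFiniteLimits G.obj := G.property.1
    have : PreservesFiniteColimits G.obj := G.property.2
    have h₁ : PreservesFiniteLimits (e.functor ⋙ G.obj) := comp_preservesFiniteLimits _ _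
    have h₂ : PreservesFiniteColimits (e.functor ⋙ G.obj) := comp_preservesFiniteColimits _ _
    exact ⟨comp_preservesFiniteLimits _ _, comp_preservesFiniteColimits _ _⟩⟩

/-- The restriction along `j : R ⥤+ B` of an exact functor on `B`; it is additive. -/
def restrict (j : R ⥤+ B) (E : B ⥤ₑ D) : R ⥤+ D :=
  ⟨j.obj ⋙ E.obj, by
    have : E.obj.Additive := ((AdditiveFunctor.ofExact B D).obj E).property
    exact inferInstanceAs (j.obj ⋙ E.obj).Additive⟩

end Restriction

end FreeAb

/-! The free abelian category is obtained by adjoining finite direct sums, then kernels, then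
cokernels. An object of `RightFreyd V` is an arrow of `V` regarded as the formal cokernel of its
map; a morphism is the right component of a commutative square, modulo maps that factor through the
target arrow. This adjoins cokernels to an additive `V`, gives an abelian category when `V` also has
pullbacks, and extends a pullback-preserving functor to an exact one (`lift_map_exact`). Dually,
`(RightFreyd Cᵒᵖ)ᵒᵖ` adjoins kernels to `C`, a small model of `Mat_ R`; applying `RightFreyd` to it
gives the free abelian category.

The rest is formal. For an exact `F`, the maps inverted in the quotient by `ker F` are exactly those
that `F` inverts, so the quotient does not change when `F` is factored through a localisation
functor (`exists_equivalence_serreQuotient`). Independence of choices and the recovery of `G` from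
`M` are two cases of this, the factorisation coming from uniqueness of exact extensions.

To present an abelian `A`, take a small model of it as `R` and extend its identity to an exact `E`.
The functor from `R` to the quotient by `ker E` is exact, because the induced functor reflects
exactness, and uniqueness of extensions makes it a quasi-inverse
(`nonempty_serreQuotient_equivalence`). -/

namespace CategoryTheory.Preadditive.RightFreyd

open Arrow

noncomputable section

variable {V : Type*} [Category* V] [Preadditive V]

lemma quotient_map_eq_zero_of_right {u v : Arrow V} (f : u ⟶ v) (h : u.right ⟶ v.left)
    (comm : f.right = h ≫ v.hom) : (quotient V).map f = 0 :=
  (quotient_map_eq_zero_iff f).2 ⟨⟨h, by rw [comm]; exact sub_zero _⟩⟩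

lemma exists_of_quotient_map_eq_zero {u v : Arrow V} {f : u ⟶ v} (hf : (quotient V).map f = 0) :
    ∃ h : u.right ⟶ v.left, f.right = h ≫ v.hom := by
  obtain ⟨h⟩ := (quotient_map_eq_zero_iff f).1 hf
  exact ⟨h.hom, by rw [← h.comm]; exact (sub_zero _).symm⟩

lemma quotient_map_eq_of_right {u v : Arrow V} (f g : u ⟶ v) (h : u.right ⟶ v.left)
    (comm : f.right - g.right = h ≫ v.hom) : (quotient V).map f = (quotient V).map g :=
  eq_of_rightHomotopy _ _ ⟨h, comm⟩

lemma exists_eq_quotient_obj (X : RightFreyd V) : ∃ u, X = (quotient V).obj u := ⟨X.as, rfl⟩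

instance [HasFiniteProducts V] : HasFiniteProducts (RightFreyd V) :=
  have : HasFiniteProducts (Arrow V) := ⟨fun _ ↦ inferInstance⟩
  (quotient V).hasFiniteProducts_of_additive_of_essSurj

/-! ### Kernels and normality: the Freyd category is abelian. -/

section Kernel

variable [HasPullbacks V] {u v : Arrow V} (a : u ⟶ v)

/-- The arrow whose image in `RightFreyd V` is the kernel of the image of `a`. -/
def kernelObj : Arrow V :=
  Arrow.mk (pullback.snd u.hom (pullback.fst a.right v.hom))

/-- The morphism of arrows whose image in `RightFreyd V` is the kernel of the image of `a`. -/
def kernelHom : kernelObj a ⟶ u :=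
  Arrow.homMk (pullback.fst u.hom (pullback.fst a.right v.hom)) (pullback.fst a.right v.hom)
    pullback.condition

/-- If `m` dies in `u`, the null homotopy and `m.right` together define a map to the pullback that
is the source of `kernelObj a`; this map is a null homotopy of `m`. -/
instance mono_kernelHom : Mono ((quotient V).map (kernelHom a)) := by
  rw [Preadditive.mono_iff_cancel_zero]
  intro T m hm
  obtain ⟨T, rfl⟩ := exists_eq_quotient_obj T
  obtain ⟨m, rfl⟩ := (quotient V).map_surjective m
  rw [← Functor.map_comp] at hm
  obtain ⟨h, hh⟩ := exists_of_quotient_map_eq_zero hm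
  exact quotient_map_eq_zero_of_right _ (pullback.lift h m.right hh.symm)
    (pullback.lift_snd _ _ _).symm

lemma kernelHom_comp : (quotient V).map (kernelHom a) ≫ (quotient V).map a = 0 := by
  rw [← Functor.map_comp]
  exact quotient_map_eq_zero_of_right _ (pullback.snd a.right v.hom) pullback.condition

variable {a} in
/-- The factorization through `kernelHom a` of a morphism `b` such that `b ≫ a` is right homotopic
to zero. -/
def kernelLift {t : Arrow V} (b : t ⟶ u) (h : t.right ⟶ v.left)
    (comm : b.right ≫ a.right = h ≫ v.hom) : t ⟶ kernelObj a :=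
  Arrow.homMk (pullback.lift b.left (t.hom ≫ pullback.lift b.right h comm)
    ((Arrow.w b).trans (by rw [Category.assoc, pullback.lift_fst])))
    (pullback.lift b.right h comm) (pullback.lift_snd _ _ _)

variable {a} in
lemma exists_kernelLift {t : RightFreyd V} (b : t ⟶ (quotient V).obj u)
    (hb : b ≫ (quotient V).map a = 0) : ∃ l, l ≫ (quotient V).map (kernelHom a) = b := by
  obtain ⟨t, rfl⟩ := exists_eq_quotient_obj t
  obtain ⟨b, rfl⟩ := (quotient V).map_surjective b
  rw [← Functor.map_comp] at hb
  obtain ⟨h, hh⟩ := exists_of_quotient_map_eq_zero hb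
  refine ⟨(quotient V).map (kernelLift b h hh), ?_⟩
  rw [← Functor.map_comp]
  congr 1
  ext
  · exact pullback.lift_fst _ _ _
  · exact pullback.lift_fst _ _ _

/-- The image of `kernelHom a` is a kernel of the image of `a`. -/
def isLimitKernelFork :
    IsLimit (KernelFork.ofι ((quotient V).map (kernelHom a)) (kernelHom_comp a)) :=
  KernelFork.IsLimit.ofι' _ _ fun b hb ↦
    ⟨(exists_kernelLift b hb).choose, (exists_kernelLift b hb).choose_spec⟩

instance : HasKernels (RightFreyd V) where
  has_limit {X Y} f := ⟨by
    obtain ⟨X, rfl⟩ := exists_eq_quotient_obj X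
    obtain ⟨Y, rfl⟩ := exists_eq_quotient_obj Y
    obtain ⟨f, rfl⟩ := (quotient V).map_surjective f
    exact ⟨_, isLimitKernelFork f⟩⟩

end Kernel

section Normal

variable [HasPullbacks V] [HasBinaryBiproducts V] {u v : Arrow V} (a : u ⟶ v)

/-- Vanishing in the cokernel means `b.right = r ≫ v.hom + s ≫ a.right`, and `s` is the right
component of the lift. It extends to a square because `t.hom ≫ s` lifts to the pullback of `a.right`
and `v.hom`, whose projection factors through `u.hom` when the kernel is zero. -/
lemma exists_lift_of_mono [Mono ((quotient V).map a)] {t : RightFreyd V}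
    (b : t ⟶ (quotient V).obj v) (hb : b ≫ (quotient V).map (Candidate.π a) = 0) :
    ∃ l, l ≫ (quotient V).map a = b := by
  obtain ⟨t, rfl⟩ := exists_eq_quotient_obj t
  obtain ⟨b, rfl⟩ := (quotient V).map_surjective b
  rw [← Functor.map_comp] at hb
  obtain ⟨h, hh⟩ := exists_of_quotient_map_eq_zero hb
  have hb' : b.right = (h ≫ biprod.fst) ≫ v.hom + (h ≫ biprod.snd) ≫ a.right := by
    have : b.right = h ≫ biprod.desc v.hom a.right := by
      rw [← Category.comp_id b.right]; exact hh
    rw [this, biprod.desc_eq]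
    simp
  have hk : (quotient V).map (kernelHom a) = 0 := by
    rw [← cancel_mono ((quotient V).map a), kernelHom_comp, zero_comp]
  obtain ⟨k, hk⟩ : ∃ k : pullback a.right v.hom ⟶ u.left, pullback.fst _ _ = k ≫ u.hom :=
    exists_of_quotient_map_eq_zero hk
  have comm : (t.hom ≫ h ≫ biprod.snd) ≫ a.right =
      (b.left - t.hom ≫ h ≫ biprod.fst) ≫ v.hom := by
    rw [Preadditive.sub_comp, Arrow.w b, hb']
    simp
  have hk' : t.hom ≫ h ≫ biprod.snd = (pullback.lift _ _ comm ≫ k) ≫ u.hom := by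
    rw [Category.assoc, ← hk]
    exact (pullback.lift_fst _ _ _).symm
  refine ⟨(quotient V).map (Arrow.homMk (pullback.lift _ _ comm ≫ k) (h ≫ biprod.snd) hk'.symm), ?_⟩
  rw [← Functor.map_comp]
  refine (quotient_map_eq_of_right _ _ (h ≫ biprod.fst) ?_).symm
  rw [hb']
  exact add_sub_cancel_right _ _

/-- A zero cokernel gives `𝟙 = r ≫ v.hom + s ≫ a.right`, and `s ≫ b.right` is the right component of
the factorisation. Two maps lift to the pullback on which `b` is null: `v.hom ≫ s` gives the
commutative square, and `a.right ≫ s - 𝟙` the homotopy to `b`. -/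
lemma exists_desc_of_epi [Epi ((quotient V).map a)] {t : RightFreyd V}
    (b : (quotient V).obj u ⟶ t) (hb : (quotient V).map (kernelHom a) ≫ b = 0) :
    ∃ l, (quotient V).map a ≫ l = b := by
  obtain ⟨t, rfl⟩ := exists_eq_quotient_obj t
  obtain ⟨b, rfl⟩ := (quotient V).map_surjective b
  rw [← Functor.map_comp] at hb
  obtain ⟨h, hh⟩ : ∃ h : pullback a.right v.hom ⟶ t.left,
      pullback.fst a.right v.hom ≫ b.right = h ≫ t.hom := exists_of_quotient_map_eq_zero hb
  have hk : (quotient V).map (Candidate.π a) = 0 := by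
    rw [← cancel_epi ((quotient V).map a), comp_zero, ← Functor.map_comp]
    exact eq_of_rightHomotopy _ _ (Candidate.condition a)
  obtain ⟨k, hk⟩ := exists_of_quotient_map_eq_zero hk
  have hk : 𝟙 v.right = (k ≫ biprod.fst) ≫ v.hom + (k ≫ biprod.snd) ≫ a.right := by
    have : 𝟙 v.right = k ≫ biprod.desc v.hom a.right := hk
    rw [this, biprod.desc_eq]
    simp
  generalize k ≫ biprod.fst = r at hk
  generalize k ≫ biprod.snd = s at hk
  have comm : (v.hom ≫ s) ≫ a.right = (𝟙 _ - v.hom ≫ r) ≫ v.hom := by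
    have := congr(v.hom ≫ $hk)
    simp only [Preadditive.comp_add, Category.comp_id] at this
    rw [Preadditive.sub_comp, Category.id_comp, eq_sub_iff_add_eq, Category.assoc, Category.assoc,
      add_comm, ← this]
  have comm' : (a.right ≫ s - 𝟙 _) ≫ a.right = (-(a.right ≫ r)) ≫ v.hom := by
    have := congr(a.right ≫ $hk)
    simp only [Preadditive.comp_add, Category.comp_id] at this
    rw [Preadditive.sub_comp, Category.id_comp, Preadditive.neg_comp, sub_eq_iff_eq_add,
      Category.assoc, Category.assoc, neg_add_eq_sub, eq_sub_iff_add_eq, add_comm, ← this]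
  have w : (pullback.lift _ _ comm ≫ h) ≫ t.hom = v.hom ≫ s ≫ b.right := by
    rw [Category.assoc, ← hh, pullback.lift_fst_assoc, Category.assoc]
  refine ⟨(quotient V).map (Arrow.homMk (pullback.lift _ _ comm ≫ h) (s ≫ b.right) w), ?_⟩
  rw [← Functor.map_comp]
  refine quotient_map_eq_of_right _ _ (pullback.lift _ _ comm' ≫ h) ?_
  rw [Category.assoc, ← hh, pullback.lift_fst_assoc, Preadditive.sub_comp, Category.id_comp,
    Category.assoc]
  exact Eq.refl (a.right ≫ s ≫ b.right - b.right)

instance : IsNormalMonoCategory (RightFreyd V) where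
  normalMonoOfMono {X Y} f _ := by
    obtain ⟨X, rfl⟩ := exists_eq_quotient_obj X
    obtain ⟨Y, rfl⟩ := exists_eq_quotient_obj Y
    obtain ⟨f, rfl⟩ := (quotient V).map_surjective f
    exact ⟨{
      Z := _
      g := (quotient V).map (Candidate.π f)
      w := by
        rw [← Functor.map_comp]
        exact eq_of_rightHomotopy _ _ (Candidate.condition f)
      isLimit := KernelFork.IsLimit.ofι' _ _ fun b hb ↦
        ⟨(exists_lift_of_mono f b hb).choose, (exists_lift_of_mono f b hb).choose_spec⟩ }⟩

instance : IsNormalEpiCategory (RightFreyd V) where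
  normalEpiOfEpi {X Y} f _ := by
    obtain ⟨X, rfl⟩ := exists_eq_quotient_obj X
    obtain ⟨Y, rfl⟩ := exists_eq_quotient_obj Y
    obtain ⟨f, rfl⟩ := (quotient V).map_surjective f
    exact ⟨{
      W := _
      g := (quotient V).map (kernelHom f)
      w := kernelHom_comp f
      isColimit := CokernelCofork.IsColimit.ofπ' _ _ fun b hb ↦
        ⟨(exists_desc_of_epi f b hb).choose, (exists_desc_of_epi f b hb).choose_spec⟩ }⟩

end Normal

/-- If `V` is an additive category with pullbacks, then `RightFreyd V` is abelian. -/
instance [HasBinaryBiproducts V] [HasFiniteProducts V] [HasPullbacks V] :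
    Abelian (RightFreyd V) where

section Presentation

variable [HasZeroObject V]

variable (V) in
/-- The object `u` is a quotient of the image of `u.right`. -/
def functorObjHom (u : Arrow V) : (functor V).obj u.right ⟶ (quotient V).obj u :=
  (quotient V).map (Arrow.homMk 0 (𝟙 _) (zero_comp.trans (Category.comp_id _).symm))

end Presentation

end

end CategoryTheory.Preadditive.RightFreyd

/-! ### Extending functors and natural transformations to the Freyd category. -/

namespace CategoryTheory.Preadditive.RightFreyd

open Arrow

noncomputable section

variable {V : Type*} [Category* V] [Preadditive V]

section Extension

variable [HasZeroObject V] {D : Type*} [Category* D]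

lemma functor_map_comp_functorObjHom {u v : Arrow V} (f : u ⟶ v) :
    (functor V).map f.right ≫ functorObjHom V v =
      functorObjHom V u ≫ (quotient V).map f := by
  change (quotient V).map _ ≫ (quotient V).map _ = (quotient V).map _ ≫ _
  rw [← Functor.map_comp, ← Functor.map_comp]
  refine quotient_map_eq_of_right _ _ 0 ?_
  change f.right ≫ 𝟙 _ - 𝟙 _ ≫ f.right = _
  rw [Category.comp_id, Category.id_comp, sub_self]
  exact zero_comp.symm

lemma functor_map_hom_comp_functorObjHom (u : Arrow V) :
    (functor V).map u.hom ≫ functorObjHom V u = 0 := by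
  change (quotient V).map _ ≫ (quotient V).map _ = _
  rw [← Functor.map_comp]
  exact quotient_map_eq_zero_of_right _ (𝟙 u.left)
    ((Category.comp_id _).trans (Category.id_comp _).symm)

instance (u : Arrow V) : Epi (functorObjHom V u) :=
  @epi_of_isIso_right V _ _ ((rightFunctor V).obj u.right) u
    (Arrow.homMk 0 (𝟙 _) (zero_comp.trans (Category.comp_id _).symm))
    (inferInstanceAs (IsIso (𝟙 u.right)))

lemma exists_functorObjHom_comp_eq (u : Arrow V) {w : RightFreyd V}
    (t : (functor V).obj u.right ⟶ w) (ht : (functor V).map u.hom ≫ t = 0) :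
    ∃ l, functorObjHom V u ≫ l = t := by
  obtain ⟨w, rfl⟩ := exists_eq_quotient_obj w
  obtain ⟨t, rfl⟩ := (quotient V).map_surjective t
  change (quotient V).map _ ≫ _ = _ at ht
  rw [← Functor.map_comp] at ht
  obtain ⟨h, hh⟩ : ∃ h : u.left ⟶ w.left, u.hom ≫ t.right = h ≫ w.hom :=
    exists_of_quotient_map_eq_zero ht
  refine ⟨(quotient V).map (Arrow.homMk h t.right hh.symm), ?_⟩
  change (quotient V).map _ ≫ _ = _
  rw [← Functor.map_comp]
  refine quotient_map_eq_of_right _ _ 0 ?_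
  change 𝟙 _ ≫ t.right - t.right = _
  rw [Category.id_comp, sub_self]
  exact zero_comp.symm

/-- The object defined by an arrow `u` is the cokernel of the image of `u.hom`. -/
def isColimitFunctorObjHom (u : Arrow V) :
    IsColimit (CokernelCofork.ofπ (functorObjHom V u) (functor_map_hom_comp_functorObjHom u)) :=
  CokernelCofork.IsColimit.ofπ' _ _ fun t ht ↦
    ⟨(exists_functorObjHom_comp_eq u t ht).choose, (exists_functorObjHom_comp_eq u t ht).choose_spec⟩

variable [Preadditive D] (G : RightFreyd V ⥤ D) [G.PreservesZeroMorphisms]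
    [∀ (u : Arrow V), PreservesColimit (parallelPair ((functor V).map u.hom) 0) G]

/-- The image of the presentation of an object by a functor which preserves cokernels. -/
def isColimitMapFunctorObjHom (u : Arrow V) :
    IsColimit (CokernelCofork.ofπ (f := G.map ((functor V).map u.hom)) (G.map (functorObjHom V u))
      (by rw [← G.map_comp, functor_map_hom_comp_functorObjHom, G.map_zero])) :=
  CokernelCofork.isColimitMapCoconeEquiv _ G
    (isColimitOfPreserves G (isColimitFunctorObjHom u))

lemma epi_map_functorObjHom (u : Arrow V) : Epi (G.map (functorObjHom V u)) :=
  Cofork.IsColimit.epi (isColimitMapFunctorObjHom G u)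

/-- Natural transformations extend uniquely from `V` to `RightFreyd V` if their source preserves
cokernels. -/
lemma whiskerLeft_functor_bijective (H : RightFreyd V ⥤ D) [H.PreservesZeroMorphisms] :
    Function.Bijective (fun β : G ⟶ H ↦ Functor.whiskerLeft (functor V) β) := by
  constructor
  · intro β β' h
    ext X
    obtain ⟨u, rfl⟩ := exists_eq_quotient_obj X
    have := epi_map_functorObjHom G u
    have h' := NatTrans.congr_app h u.right
    change β.app _ = β'.app _ at h'
    rw [← cancel_epi (G.map (functorObjHom V u)), NatTrans.naturality, NatTrans.naturality, h']
  · intro α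
    -- `G` preserves the presentation of `u` as a cokernel, so the component at `u` is forced by `α`
    -- at `u.right`; naturality at `u.hom` makes it exist.
    have key (u : Arrow V) : ∃ l : G.obj ((quotient V).obj u) ⟶ H.obj ((quotient V).obj u),
        G.map (functorObjHom V u) ≫ l = α.app u.right ≫ H.map (functorObjHom V u) := by
      refine ⟨(isColimitMapFunctorObjHom G u).desc (CokernelCofork.ofπ
        (α.app u.right ≫ H.map (functorObjHom V u)) ?_),
        Cofork.IsColimit.π_desc (isColimitMapFunctorObjHom G u)⟩
      refine (α.naturality_assoc u.hom (H.map (functorObjHom V u))).trans ?_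
      rw [Functor.comp_map, ← H.map_comp, functor_map_hom_comp_functorObjHom, H.map_zero, comp_zero]
    choose l hl using key
    obtain ⟨β, hβ⟩ : ∃ β : ∀ X, G.obj X ⟶ H.obj X, ∀ u, G.map (functorObjHom V u) ≫
        β ((quotient V).obj u) = α.app u.right ≫ H.map (functorObjHom V u) := ⟨fun X ↦ l X.as, hl⟩
    refine ⟨{ app := β, naturality := ?_ }, ?_⟩
    · intro X Y f
      obtain ⟨u, rfl⟩ := exists_eq_quotient_obj X
      obtain ⟨v, rfl⟩ := exists_eq_quotient_obj Y
      obtain ⟨f, rfl⟩ := (quotient V).map_surjective f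
      have := epi_map_functorObjHom G u
      rw [← cancel_epi (G.map (functorObjHom V u)), ← G.map_comp_assoc,
        ← functor_map_comp_functorObjHom, G.map_comp_assoc]
      rw [hβ, reassoc_of% (hβ u), ← H.map_comp, ← functor_map_comp_functorObjHom, H.map_comp]
      exact α.naturality_assoc _ _
    · ext X
      have : functorObjHom V ((rightFunctor V).obj X) = 𝟙 _ := by
        change (quotient V).map _ = (quotient V).map (𝟙 _)
        exact quotient_map_eq_of_right _ _ 0 ((sub_self _).trans zero_comp.symm)
      have h := hβ ((rightFunctor V).obj X)
      rw [this] at h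
      erw [G.map_id, H.map_id] at h
      exact (Category.id_comp _).symm.trans (h.trans (Category.comp_id _))

end Extension

section Kernels

variable [HasZeroObject V]

/-- The arrow representing an object of `V` has zero source, so homotopies into it are trivial and
the cancellation takes place in `V`. -/
lemma mono_functor_map {X Y : V} (f : X ⟶ Y) [Mono f] : Mono ((functor V).map f) := by
  rw [Preadditive.mono_iff_cancel_zero]
  intro T m hm
  obtain ⟨T, rfl⟩ := exists_eq_quotient_obj T
  obtain ⟨m, rfl⟩ := (quotient V).map_surjective m
  change _ ≫ (quotient V).map _ = 0 at hm
  rw [← Functor.map_comp] at hm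
  obtain ⟨h, hh⟩ := exists_of_quotient_map_eq_zero hm
  have hh : m.right ≫ f = 0 := hh.trans comp_zero
  refine quotient_map_eq_zero_of_right _ 0 (((cancel_mono f).1 ?_).trans zero_comp.symm)
  exact hh.trans zero_comp.symm

lemma exists_comp_functor_map_eq {K X Y : V} {i : K ⟶ X} {f : X ⟶ Y} {w : i ≫ f = 0}
    (hi : IsLimit (KernelFork.ofι i w)) {T : RightFreyd V} (t : T ⟶ (functor V).obj X)
    (ht : t ≫ (functor V).map f = 0) : ∃ l, l ≫ (functor V).map i = t := by
  obtain ⟨T, rfl⟩ := exists_eq_quotient_obj T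
  obtain ⟨t, rfl⟩ := (quotient V).map_surjective t
  change _ ≫ (quotient V).map _ = 0 at ht
  rw [← Functor.map_comp] at ht
  obtain ⟨h, hh⟩ := exists_of_quotient_map_eq_zero ht
  have hh : t.right ≫ f = 0 := hh.trans comp_zero
  have ht : T.hom ≫ t.right = 0 := (Arrow.w t).symm.trans comp_zero
  obtain ⟨t', ht'⟩ : ∃ t' : T.right ⟶ X, t' = t.right := ⟨_, rfl⟩
  obtain ⟨l, hl⟩ := KernelFork.IsLimit.lift' hi t' (by rw [ht']; exact hh)
  have hl : l ≫ i = t' := hl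
  have : Mono i := Fork.IsLimit.mono hi
  have hl' : T.hom ≫ l = 0 := by
    rw [← cancel_mono i, Category.assoc, hl, ht', zero_comp]
    exact ht
  refine ⟨(quotient V).map (Arrow.homMk 0 l (zero_comp.trans hl'.symm)), ?_⟩
  change _ ≫ (quotient V).map _ = _
  rw [← Functor.map_comp]
  refine quotient_map_eq_of_right _ _ 0 ?_
  refine (sub_eq_zero.2 ?_).trans zero_comp.symm
  exact hl.trans ht'

/-- The embedding of `V` in `RightFreyd V` preserves the kernels that exist in `V`. -/
lemma preservesLimit_parallelPair_functor {X Y : V} (f : X ⟶ Y) [HasKernel f] :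
    PreservesLimit (parallelPair f 0) (functor V) := by
  have : Mono ((functor V).map (Fork.ι (KernelFork.ofι (kernel.ι f) (kernel.condition f)))) :=
    mono_functor_map (kernel.ι f)
  refine preservesLimit_of_preserves_limit_cone (kernelIsKernel f)
    ((KernelFork.isLimitMapConeEquiv _ (functor V)).2 (KernelFork.IsLimit.ofι' _
      (by rw [← Functor.map_comp, KernelFork.condition, Functor.map_zero]) fun t ht ↦ ?_))
  have := exists_comp_functor_map_eq (w := kernel.condition f) (kernelIsKernel f) t ht
  exact ⟨this.choose, this.choose_spec⟩

lemma preservesFiniteLimits_functor [HasFiniteProducts V] [HasKernels V] :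
    PreservesFiniteLimits (functor V) := by
  have := fun {X Y : V} (f : X ⟶ Y) ↦ preservesLimit_parallelPair_functor f
  have : HasBinaryBiproducts V := HasBinaryBiproducts.of_hasBinaryProducts
  have : HasEqualizers V := Preadditive.hasEqualizers_of_hasKernels
  have : HasFiniteBiproducts (RightFreyd V) := HasFiniteBiproducts.of_hasFiniteProducts
  exact (functor V).preservesFiniteLimits_of_preservesKernels

end Kernels

section Lift

variable {D : Type*} [Category* D]

section

variable {V : Type*} [Category* V] [HasZeroMorphisms D] [HasCokernels D] (F : V ⥤ D)

/-- The functor which sends an arrow `u` to the cokernel of `F.map u.hom`. -/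
def arrowCokernel : Arrow V ⥤ D where
  obj u := cokernel (F.map u.hom)
  map f := cokernel.map _ _ (F.map f.left) (F.map f.right) (by
    rw [← F.map_comp, ← F.map_comp, Arrow.w])

/-- The projection to the cokernel of `F.map u.hom`. -/
def arrowCokernelπ (u : Arrow V) : F.obj u.right ⟶ (arrowCokernel F).obj u :=
  cokernel.π (F.map u.hom)

lemma map_hom_comp_arrowCokernelπ (u : Arrow V) : F.map u.hom ≫ arrowCokernelπ F u = 0 :=
  cokernel.condition _

instance (u : Arrow V) : Epi (arrowCokernelπ F u) :=
  inferInstanceAs (Epi (cokernel.π (F.map u.hom)))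

lemma arrowCokernelπ_map {u v : Arrow V} (f : u ⟶ v) :
    arrowCokernelπ F u ≫ (arrowCokernel F).map f = F.map f.right ≫ arrowCokernelπ F v :=
  cokernel.π_desc _ _ _

end

variable [Preadditive D] [HasCokernels D] (F : V ⥤ D) [F.Additive]

/-- The extension to `RightFreyd V` of an additive functor `F` from `V` to a category with
cokernels: it sends an arrow `u` to the cokernel of `F.map u.hom`. -/
def lift : RightFreyd V ⥤ D :=
  Quotient.lift _ (arrowCokernel F) (by
    rintro u v f g ⟨h⟩
    rw [← cancel_epi (arrowCokernelπ F u), arrowCokernelπ_map, arrowCokernelπ_map,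
      ← sub_eq_zero, ← Preadditive.sub_comp, ← F.map_sub, h.comm, F.map_comp, Category.assoc,
      map_hom_comp_arrowCokernelπ, comp_zero])

/-- The projection to the value of `lift F` at an arrow `u`. -/
def liftπ (u : Arrow V) : F.obj u.right ⟶ (lift F).obj ((quotient V).obj u) :=
  arrowCokernelπ F u

instance (u : Arrow V) : Epi (liftπ F u) :=
  inferInstanceAs (Epi (arrowCokernelπ F u))

lemma map_hom_comp_liftπ (u : Arrow V) : F.map u.hom ≫ liftπ F u = 0 :=
  cokernel.condition _

/-- The value of `lift F` at an arrow `u` is the cokernel of `F.map u.hom`. -/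
def isColimitLiftπ (u : Arrow V) :
    IsColimit (CokernelCofork.ofπ (liftπ F u) (map_hom_comp_liftπ F u)) :=
  cokernelIsCokernel (F.map u.hom)

lemma liftπ_map {u v : Arrow V} (f : u ⟶ v) :
    liftπ F u ≫ (lift F).map ((quotient V).map f) = F.map f.right ≫ liftπ F v :=
  arrowCokernelπ_map F f

instance : (lift F).Additive where
  map_add {X Y f g} := by
    obtain ⟨u, rfl⟩ := exists_eq_quotient_obj X
    obtain ⟨v, rfl⟩ := exists_eq_quotient_obj Y
    obtain ⟨f, rfl⟩ := (quotient V).map_surjective f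
    obtain ⟨g, rfl⟩ := (quotient V).map_surjective g
    rw [← Functor.map_add, ← cancel_epi (liftπ F u), Preadditive.comp_add, liftπ_map, liftπ_map,
      liftπ_map, ← Preadditive.add_comp, ← F.map_add]
    rfl

/-- `lift F` extends `F`. -/
def functorLiftIso [HasZeroObject V] : functor V ⋙ lift F ≅ F :=
  (NatIso.ofComponents
    (fun X ↦ @asIso _ _ _ _ (liftπ F ((rightFunctor V).obj X))
      (CokernelCofork.IsColimit.isIso_π _ (isColimitLiftπ F _) (F.map_zero _ _)))
    (fun f ↦ (liftπ_map F ((rightFunctor V).map f)).symm)).symm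

section Cokernels

variable [HasBinaryBiproducts V]

/-- The cokernel of `f` is presented by `v.left ⊞ u.right ⟶ v.right`; a map out of it amounts to a
map on `F.obj v.right` killing both `F.map v.hom` and `F.map f.right`. -/
lemma exists_lift_map_π_comp_eq {u v : Arrow V} (f : u ⟶ v) {T : D}
    (t : (lift F).obj ((quotient V).obj v) ⟶ T) (ht : (lift F).map ((quotient V).map f) ≫ t = 0) :
    ∃ l, (lift F).map ((quotient V).map (Candidate.π f)) ≫ l = t := by
  obtain ⟨l, hl⟩ := CokernelCofork.IsColimit.desc' (isColimitLiftπ F (Candidate.cokernel f))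
    (liftπ F v ≫ t) (by
      change F.map (biprod.desc v.hom f.right) ≫ _ = _
      rw [biprod.desc_eq, F.map_add, F.map_comp, F.map_comp, Preadditive.add_comp, Category.assoc,
        Category.assoc, ← Category.assoc (F.map f.right), ← liftπ_map, Category.assoc, ht,
        ← Category.assoc (F.map v.hom), map_hom_comp_liftπ]
      simp)
  refine ⟨l, ?_⟩
  rw [← cancel_epi (liftπ F v), ← Category.assoc, liftπ_map]
  refine Eq.trans ?_ hl
  change (F.map (𝟙 v.right) ≫ _) ≫ _ = _
  rw [F.map_id, Category.id_comp]
  rfl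

lemma epi_lift_map_π {u v : Arrow V} (f : u ⟶ v) :
    Epi ((lift F).map ((quotient V).map (Candidate.π f))) := by
  have h : liftπ F v ≫ (lift F).map ((quotient V).map (Candidate.π f)) =
      liftπ F (Candidate.cokernel f) := by
    rw [liftπ_map]
    change F.map (𝟙 v.right) ≫ _ = _
    rw [F.map_id]
    exact Category.id_comp _
  have : Epi (liftπ F v ≫ (lift F).map ((quotient V).map (Candidate.π f))) := by
    rw [h]
    infer_instance
  exact epi_of_epi (liftπ F v) _

lemma preservesColimit_parallelPair_lift {X Y : RightFreyd V} (f : X ⟶ Y) :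
    PreservesColimit (parallelPair f 0) (lift F) := by
  obtain ⟨u, rfl⟩ := exists_eq_quotient_obj X
  obtain ⟨v, rfl⟩ := exists_eq_quotient_obj Y
  obtain ⟨f, rfl⟩ := (quotient V).map_surjective f
  have : Epi ((lift F).map (Cofork.π (Candidate.cokernelCofork f))) := epi_lift_map_π F f
  refine preservesColimit_of_preserves_colimit_cocone (Candidate.isColimitCokernelCofork f)
    ((CokernelCofork.isColimitMapCoconeEquiv _ (lift F)).2 (CokernelCofork.IsColimit.ofπ' _
      (by rw [← Functor.map_comp, CokernelCofork.condition, Functor.map_zero]) fun t ht ↦ ?_))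
  have := exists_lift_map_π_comp_eq F f t ht
  exact ⟨this.choose, this.choose_spec⟩

/-- The functor `lift F` is right exact. -/
lemma preservesFiniteColimits_lift [HasFiniteProducts V] [HasZeroObject D] :
    PreservesFiniteColimits (lift F) := by
  have := fun {X Y : RightFreyd V} (f : X ⟶ Y) ↦ preservesColimit_parallelPair_lift F f
  have : HasFiniteBiproducts (RightFreyd V) := HasFiniteBiproducts.of_hasFiniteProducts
  have : HasBinaryBiproducts (RightFreyd V) := hasBinaryBiproducts_of_finite_biproducts _
  have : HasFiniteCoproducts (RightFreyd V) := inferInstance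
  have : HasCoequalizers (RightFreyd V) := Preadditive.hasCoequalizers_of_hasCokernels
  exact (lift F).preservesFiniteColimits_of_preservesCokernels

end Cokernels

end Lift

section Exact

variable {D : Type*} [Category* D] [Abelian D] (F : V ⥤ D) [F.Additive]
  [HasBinaryBiproducts V] [HasPullbacks V] [PreservesLimitsOfShape WalkingCospan F]

/-- If `F` preserves pullbacks, then `lift F` preserves exact sequences. -/
lemma lift_map_exact (S : ShortComplex (RightFreyd V)) (hS : S.Exact) :
    (S.map (lift F)).Exact := by
  obtain ⟨f, g, w⟩ := S
  rename_i X Y Z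
  obtain ⟨x, rfl⟩ := exists_eq_quotient_obj X
  obtain ⟨y, rfl⟩ := exists_eq_quotient_obj Y
  obtain ⟨z, rfl⟩ := exists_eq_quotient_obj Z
  obtain ⟨a, rfl⟩ := (quotient V).map_surjective f
  obtain ⟨b, rfl⟩ := (quotient V).map_surjective g
  -- By exactness the kernel of `b` maps to zero in the cokernel of `a`; a null homotopy writes the
  -- pullback projection to `y.right` as `r ≫ y.hom + s ≫ a.right`.
  have hk := hS.comp_eq_zero (kernelHom_comp b) (b := (quotient V).map (Candidate.π a)) (by
    dsimp only
    rw [← Functor.map_comp]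
    exact eq_of_rightHomotopy _ _ (Candidate.condition a))
  rw [← Functor.map_comp] at hk
  obtain ⟨h, hh⟩ : ∃ h : pullback b.right z.hom ⟶ y.left ⊞ x.right,
      pullback.fst b.right z.hom ≫ 𝟙 _ = h ≫ biprod.desc y.hom a.right :=
    exists_of_quotient_map_eq_zero hk
  rw [Category.comp_id, biprod.desc_eq, Preadditive.comp_add, ← Category.assoc,
    ← Category.assoc] at hh
  generalize h ≫ biprod.fst = r at hh
  generalize h ≫ biprod.snd = s at hh
  rw [ShortComplex.exact_iff_exact_up_to_refinements]
  intro A t ht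
  change A ⟶ (lift F).obj ((quotient V).obj y) at t
  change t ≫ (lift F).map ((quotient V).map b) = 0 at ht
  -- After two refinements `t` comes from a map to `F` of the pullback, since `F` preserves it. The
  -- `r` term dies in the cokernel of `F.map y.hom`, so `s` provides the preimage under `a`.
  obtain ⟨A₁, p₁, _, t₁, ht₁⟩ := surjective_up_to_refinements_of_epi (liftπ F y) t
  have h₁ : (t₁ ≫ F.map b.right) ≫ liftπ F z = 0 := by
    rw [Category.assoc, ← liftπ_map, ← Category.assoc, ← ht₁, Category.assoc, ht, comp_zero]
  obtain ⟨A₂, p₂, _, t₂, ht₂⟩ :=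
    (CokernelCofork.IsColimit.comp_π_eq_zero_iff_up_to_refinements (isColimitLiftπ F z) _).1 h₁
  have hP := (IsPullback.of_hasPullback b.right z.hom).map F
  have hP₁ := hP.lift_fst (p₂ ≫ t₁) t₂ (by rw [Category.assoc, ht₂])
  generalize hP.lift (p₂ ≫ t₁) t₂ (by rw [Category.assoc, ht₂]) = k at hP₁
  have fac : (p₂ ≫ p₁) ≫ t =
      (k ≫ F.map s ≫ liftπ F x) ≫ (lift F).map ((quotient V).map a) := by
    rw [Category.assoc, Category.assoc, Category.assoc, liftπ_map, ← F.map_comp_assoc, ht₁,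
      ← Category.assoc, ← hP₁, hh, F.map_add, Preadditive.comp_add, Preadditive.add_comp,
      F.map_comp r]
    simp only [Category.assoc, map_hom_comp_liftπ, comp_zero, zero_add]
  exact ⟨A₂, p₂ ≫ p₁, epi_comp _ _, _, fac⟩

/-- If `F` preserves pullbacks, then `lift F` is exact. -/
lemma exact_lift [HasFiniteProducts V] : PreservesFiniteLimits (lift F) ∧ PreservesFiniteColimits (lift F) :=
  ((lift F).exact_tfae.out 1 3).1 (lift_map_exact F)

end Exact

end

end CategoryTheory.Preadditive.RightFreyd

/-! ### Additive closure: extension from `R` to `Mat_ R`. -/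

namespace CategoryTheory

noncomputable section

/-- If precomposition with `k` is bijective on the natural transformations between the functors
which satisfy `P`, then isomorphisms between these functors extend along `k`. -/
lemma exists_iso_of_whiskerLeft_bijective {R C D : Type*} [Category* R] [Category* C] [Category* D]
    (k : R ⥤ C) (P : ObjectProperty (C ⥤ D))
    (h : ∀ G H, P G → P H → Function.Bijective (fun β : G ⟶ H ↦ Functor.whiskerLeft k β))
    {G H : C ⥤ D} (hG : P G) (hH : P H) (α : k ⋙ G ≅ k ⋙ H) :
    ∃ β : G ≅ H, Functor.isoWhiskerLeft k β = α := by
  obtain ⟨b, hb⟩ := (h G H hG hH).2 α.hom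
  obtain ⟨b', hb'⟩ := (h H G hH hG).2 α.inv
  dsimp only at hb hb'
  refine ⟨⟨b, b', (h G G hG hG).1 ?_, (h H H hH hH).1 ?_⟩, Iso.ext hb⟩
  · dsimp only
    rw [Functor.whiskerLeft_comp, hb, hb', α.hom_inv_id]
    rfl
  · dsimp only
    rw [Functor.whiskerLeft_comp, hb, hb', α.inv_hom_id]
    rfl

section Generators

variable {R C D : Type*} [Category* R] [Category* C] [Category* D] [Preadditive C] [Preadditive D]

/-- Natural transformations between additive functors extend uniquely along a full functor `k` if
all objects are retracts of finite direct sums of objects in the image of `k`. -/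
lemma whiskerLeft_bijective_of_sum_eq_id (k : R ⥤ C) [k.Full]
    (hk : ∀ M : C, ∃ (J : Type) (_ : Fintype J) (X : J → R) (p : ∀ i, M ⟶ k.obj (X i))
      (q : ∀ i, k.obj (X i) ⟶ M), ∑ i, p i ≫ q i = 𝟙 M)
    (G H : C ⥤ D) [G.Additive] [H.Additive] :
    Function.Bijective (fun β : G ⟶ H ↦ Functor.whiskerLeft k β) := by
  choose J _ X p q hpq using hk
  constructor
  · intro β β' h
    ext M
    have h' (i : J M) : β.app (k.obj (X M i)) = β'.app (k.obj (X M i)) := NatTrans.congr_app h _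
    rw [← Category.id_comp (β.app M), ← Category.id_comp (β'.app M), ← G.map_id, ← hpq M,
      G.map_sum, Preadditive.sum_comp, Preadditive.sum_comp]
    refine Finset.sum_congr rfl fun i _ ↦ ?_
    rw [G.map_comp, Category.assoc, Category.assoc, NatTrans.naturality, NatTrans.naturality, h']
  · intro α
    have nat {Y Z : R} (f : k.obj Y ⟶ k.obj Z) : G.map f ≫ α.app Z = α.app Y ≫ H.map f := by
      obtain ⟨f, rfl⟩ := k.map_surjective f
      exact α.naturality f
    refine ⟨{ app M := ∑ i, G.map (p M i) ≫ α.app (X M i) ≫ H.map (q M i), naturality := ?_ }, ?_⟩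
    -- Inserting the decomposition of the identity of `M` on one side and of `N` on the other gives
    -- the same double sum.
    · intro M N f
      have h₁ : G.map f ≫ ∑ j, G.map (p N j) ≫ α.app (X N j) ≫ H.map (q N j) =
          ∑ j, ∑ i, G.map (p M i) ≫ α.app (X M i) ≫ H.map (q M i ≫ f ≫ p N j) ≫
            H.map (q N j) := by
        rw [Preadditive.comp_sum]
        refine Finset.sum_congr rfl fun j _ ↦ ?_
        have : G.map (f ≫ p N j) = G.map (∑ i, (p M i ≫ q M i) ≫ f ≫ p N j) := by
          rw [← Preadditive.sum_comp, hpq, Category.id_comp]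
        rw [← G.map_comp_assoc, this, G.map_sum, Preadditive.sum_comp]
        refine Finset.sum_congr rfl fun i _ ↦ ?_
        rw [Category.assoc, G.map_comp, Category.assoc, ← Category.assoc (G.map (q M i ≫ _)), nat,
          Category.assoc]
      have h₂ : (∑ i, G.map (p M i) ≫ α.app (X M i) ≫ H.map (q M i)) ≫ H.map f =
          ∑ i, ∑ j, G.map (p M i) ≫ α.app (X M i) ≫ H.map (q M i ≫ f ≫ p N j) ≫
            H.map (q N j) := by
        rw [Preadditive.sum_comp]
        refine Finset.sum_congr rfl fun i _ ↦ ?_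
        have : H.map (q M i ≫ f) = H.map (∑ j, (q M i ≫ f) ≫ p N j ≫ q N j) := by
          rw [← Preadditive.comp_sum, hpq, Category.comp_id]
        rw [Category.assoc, Category.assoc, ← H.map_comp, this, H.map_sum, Preadditive.comp_sum, Preadditive.comp_sum]
        refine Finset.sum_congr rfl fun j _ ↦ ?_
        rw [← H.map_comp, Category.assoc, Category.assoc, Category.assoc]
      rw [h₁, h₂, Finset.sum_comm]
    · ext Y
      change ∑ i, G.map (p (k.obj Y) i) ≫ α.app (X (k.obj Y) i) ≫ H.map (q (k.obj Y) i) = α.app Y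
      have : ∀ i, G.map (p (k.obj Y) i) ≫ α.app (X (k.obj Y) i) ≫ H.map (q (k.obj Y) i) =
          α.app Y ≫ H.map (p (k.obj Y) i ≫ q (k.obj Y) i) := fun i ↦ by
        rw [← Category.assoc, nat, H.map_comp, Category.assoc]
      rw [Finset.sum_congr rfl fun i _ ↦ this i, ← Preadditive.comp_sum, ← H.map_sum, hpq, H.map_id]
      exact Category.comp_id _

end Generators

namespace Mat_

variable {R : Type u} [Category.{v} R] [Preadditive R]

lemma exists_sum_eq_id (M : Mat_ R) : ∃ (J : Type) (_ : Fintype J) (X : J → R)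
    (p : ∀ i, M ⟶ (embedding R).obj (X i)) (q : ∀ i, (embedding R).obj (X i) ⟶ M),
    ∑ i, p i ≫ q i = 𝟙 M := by
  refine ⟨M.ι, inferInstance, M.X, fun i ↦ M.isoBiproductEmbedding.hom ≫ biproduct.π _ i,
    fun i ↦ biproduct.ι (fun i ↦ (embedding R).obj (M.X i)) i ≫ M.isoBiproductEmbedding.inv, ?_⟩
  have (i : M.ι) : (M.isoBiproductEmbedding.hom ≫ biproduct.π _ i) ≫
      (biproduct.ι (fun i ↦ (embedding R).obj (M.X i)) i ≫ M.isoBiproductEmbedding.inv) =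
      M.isoBiproductEmbedding.hom ≫ (biproduct.π _ i ≫ biproduct.ι (fun i ↦ (embedding R).obj (M.X i)) i) ≫
        M.isoBiproductEmbedding.inv := by
    simp only [Category.assoc]
  rw [Finset.sum_congr rfl fun i _ ↦ this i, ← Preadditive.comp_sum, ← Preadditive.sum_comp,
    biproduct.total, Category.id_comp, Iso.hom_inv_id]

/-- Up to isomorphism, objects are biproducts of families indexed by some `Fin n` in a small model
of `R`. -/
lemma essentiallySmall [EssentiallySmall.{w} R] : EssentiallySmall.{w} (Mat_ R) := by
  rw [essentiallySmall_iff]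
  constructor
  · let f : (Σ n : ℕ, (Fin n → SmallModel.{w} R)) → Skeleton (Mat_ R) := fun t ↦
      toSkeleton (⨁ fun i ↦ (embedding R).obj ((equivSmallModel.{w} R).inverse.obj (t.2 i)))
    refine small_of_surjective (f := f) fun M ↦ ?_
    let M' := (fromSkeleton _).obj M
    let e := Fintype.equivFin M'.ι
    refine ⟨⟨Fintype.card M'.ι, fun i ↦ (equivSmallModel.{w} R).functor.obj (M'.X (e.symm i))⟩, ?_⟩
    refine toSkeleton_eq_iff.2 ⟨?_⟩
    refine biproduct.whiskerEquiv e.symm (fun i ↦ (embedding R).mapIso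
      ((equivSmallModel.{w} R).unitIso.app _)) ≪≫ M'.isoBiproductEmbedding.symm
  · exact ⟨fun M N ↦ inferInstanceAs (Small.{w} (∀ i j, M.X i ⟶ N.X j))⟩

variable {D : Type*} [Category* D] [Preadditive D] [HasFiniteBiproducts D]
  (F : R ⥤ D) [F.Additive]

attribute [local simp] biproduct.lift_desc in
/-- The extension to `Mat_ R` of an additive functor; this is `Mat_.lift` without restrictions on
the universes. -/
def extend : Mat_ R ⥤ D where
  obj X := ⨁ fun i => F.obj (X.X i)
  map f := biproduct.matrix fun i j => F.map (f i j)
  map_id X := by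
    ext i j
    by_cases h : j = i
    · subst h; simp
    · simp [h]

instance : (extend F).Additive where
  map_add {X Y f g} := by
    have key (a b : ∀ i j, F.obj (X.X i) ⟶ F.obj (Y.X j)) :
        (biproduct.matrix fun i j ↦ a i j + b i j) = biproduct.matrix a + biproduct.matrix b := by
      apply biproduct.hom_ext
      intro i
      apply biproduct.hom_ext'
      intro j
      rw [Preadditive.add_comp, Preadditive.comp_add]
      simp
    refine Eq.trans ?_ (key _ _)
    change biproduct.matrix _ = _
    congr 1
    ext i j
    exact F.map_add

/-- The functor `extend F` extends `F`. -/
def embeddingExtendIso : embedding R ⋙ extend F ≅ F :=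
  NatIso.ofComponents (fun X ↦
    { hom := biproduct.π (fun _ : PUnit ↦ F.obj X) PUnit.unit
      inv := biproduct.ι (fun _ : PUnit ↦ F.obj X) PUnit.unit
      hom_inv_id := by
        have := biproduct.total (f := fun _ : PUnit ↦ F.obj X)
        rw [Fintype.univ_ofSubsingleton, Finset.sum_singleton] at this
        exact this
      inv_hom_id := biproduct.ι_π_self _ _ }) (fun {X Y} f ↦ by
    change (biproduct.matrix fun (_ _ : PUnit) ↦ F.map f) ≫ _ =
      biproduct.π (fun _ : PUnit ↦ F.obj X) PUnit.unit ≫ _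
    apply biproduct.hom_ext'
    intro j
    rw [biproduct.matrix_π, biproduct.ι_desc, biproduct.ι_π_self_assoc])

end Mat_

namespace Preadditive.RightFreyd

variable {C D : Type*} [Category* C] [Preadditive C] [HasZeroObject C] [Category* D] [Preadditive D]

/-- Natural transformations extend uniquely from `C` to `(RightFreyd Cᵒᵖ)ᵒᵖ` if their target is left
exact. -/
lemma whiskerLeft_rightOp_functor_bijective (G H : (RightFreyd Cᵒᵖ)ᵒᵖ ⥤ D) [G.Additive] [H.Additive]
    [PreservesFiniteLimits H] :
    Function.Bijective (fun β : G ⟶ H ↦ Functor.whiskerLeft (functor Cᵒᵖ).rightOp β) := by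
  have : PreservesFiniteColimits H.rightOp := preservesFiniteColimits_rightOp H
  have h := whiskerLeft_functor_bijective H.rightOp G.rightOp
  constructor
  · intro β β' hβ
    have := h.1 (a₁ := NatTrans.rightOp β) (a₂ := NatTrans.rightOp β') (by
      ext X
      exact congr(($hβ).app X.unop |>.op))
    ext X
    exact congr(($this).app X.unop |>.unop)
  · intro α
    obtain ⟨b, hb⟩ := h.2 { app X := (α.app X.unop).op
                            naturality X Y f := congr($(α.naturality f.unop).op).symm }
    refine ⟨{ app X := (b.app X.unop).unop
              naturality X Y f := congr($(b.naturality f.unop).unop).symm }, ?_⟩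
    ext X
    exact congr(($hb).app (.op X) |>.unop)

end Preadditive.RightFreyd

end

end CategoryTheory

/-! ### The free abelian category: construction and universal property. -/

namespace FreeAb

open Preadditive

noncomputable section

section Construction

variable (C : Type u₁) [Category.{v₁} C] [Preadditive C]

instance [HasFiniteBiproducts C] : HasFiniteBiproducts Cᵒᵖ :=
  have : HasFiniteCoproducts C := inferInstance
  HasFiniteBiproducts.of_hasFiniteProducts

instance [HasFiniteBiproducts C] : HasBinaryBiproducts Cᵒᵖ :=
  hasBinaryBiproducts_of_finite_biproducts _

instance [HasFiniteBiproducts C] : HasFiniteBiproducts (RightFreyd Cᵒᵖ)ᵒᵖ :=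
  have : HasFiniteProducts (RightFreyd Cᵒᵖ) := inferInstance
  have : HasFiniteBiproducts (RightFreyd Cᵒᵖ) := HasFiniteBiproducts.of_hasFiniteProducts
  have : HasFiniteCoproducts (RightFreyd Cᵒᵖ) := inferInstance
  HasFiniteBiproducts.of_hasFiniteProducts

instance [HasFiniteBiproducts C] : HasZeroObject (RightFreyd Cᵒᵖ)ᵒᵖ :=
  hasZeroObject_of_hasFiniteBiproducts _

instance [HasFiniteBiproducts C] : HasBinaryBiproducts (RightFreyd Cᵒᵖ)ᵒᵖ :=
  hasBinaryBiproducts_of_finite_biproducts _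

/-- These are dual to the cokernels that the inner Freyd construction adjoins, and they yield the
pullbacks that make the outer one abelian. -/
instance [HasFiniteBiproducts C] : HasKernels (RightFreyd Cᵒᵖ)ᵒᵖ :=
  have : HasCoequalizers (RightFreyd Cᵒᵖ) := Preadditive.hasCoequalizers_of_hasCokernels
  inferInstance

instance [HasFiniteBiproducts C] : HasPullbacks (RightFreyd Cᵒᵖ)ᵒᵖ :=
  have : HasEqualizers (RightFreyd Cᵒᵖ)ᵒᵖ := Preadditive.hasEqualizers_of_hasKernels
  hasPullbacks_of_hasBinaryProducts_of_hasEqualizers _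

/-- The free abelian category on an additive category. -/
abbrev FreydAbelian := RightFreyd (RightFreyd Cᵒᵖ)ᵒᵖ

variable [HasFiniteBiproducts C] [HasZeroObject C]

/-- The embedding of an additive category in its free abelian category. -/
def toFreydAbelian : C ⥤ FreydAbelian C :=
  (RightFreyd.functor Cᵒᵖ).rightOp ⋙ RightFreyd.functor (RightFreyd Cᵒᵖ)ᵒᵖ

instance : (toFreydAbelian C).Full := by dsimp [toFreydAbelian]; infer_instance
instance : (toFreydAbelian C).Faithful := by dsimp [toFreydAbelian]; infer_instance
instance : (toFreydAbelian C).Additive := by dsimp [toFreydAbelian]; infer_instance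

variable {C} {D : Type u₂} [Category.{v₂} D] [Abelian D]

/-- The extension of `F.op` to the inner Freyd category is right exact. Its opposite is therefore
left exact, in particular preserves pullbacks, and so extends exactly to the outer one. -/
lemma exists_exact_extension (F : C ⥤ D) [F.Additive] :
    ∃ E : FreydAbelian C ⥤ₑ D, Nonempty (toFreydAbelian C ⋙ E.obj ≅ F) := by
  let L := RightFreyd.lift F.op
  have : PreservesFiniteColimits L := RightFreyd.preservesFiniteColimits_lift F.op
  have : PreservesFiniteLimits L.leftOp := preservesFiniteLimits_leftOp L
  have h := RightFreyd.exact_lift L.leftOp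
  let i : (RightFreyd.functor Cᵒᵖ).rightOp ⋙ L.leftOp ≅ F :=
    NatIso.ofComponents (fun X ↦ ((RightFreyd.functorLiftIso F.op).app (.op X)).unop.symm)
      (fun f ↦ congr($((RightFreyd.functorLiftIso F.op).inv.naturality f.op).unop).symm)
  exact ⟨⟨RightFreyd.lift L.leftOp, h⟩, ⟨Functor.associator _ _ _ ≪≫
    Functor.isoWhiskerLeft _ (RightFreyd.functorLiftIso L.leftOp) ≪≫ i⟩⟩

/-- The outer stage uses that `E₁` preserves cokernels. The inner one needs the restriction of `E₂`
to be left exact, which holds because the outer embedding preserves finite limits. -/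
lemma whiskerLeft_toFreydAbelian_bijective (E₁ E₂ : FreydAbelian C ⥤ₑ D) :
    Function.Bijective
      (fun β : E₁.obj ⟶ E₂.obj ↦ Functor.whiskerLeft (toFreydAbelian C) β) := by
  have : E₁.obj.Additive := ((AdditiveFunctor.ofExact _ D).obj E₁).property
  have : E₂.obj.Additive := ((AdditiveFunctor.ofExact _ D).obj E₂).property
  have : PreservesFiniteLimits E₂.obj := E₂.property.1
  have : PreservesFiniteColimits E₁.obj := E₁.property.2
  have : PreservesFiniteLimits (RightFreyd.functor (RightFreyd Cᵒᵖ)ᵒᵖ) :=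
    RightFreyd.preservesFiniteLimits_functor
  have : PreservesFiniteLimits (RightFreyd.functor (RightFreyd Cᵒᵖ)ᵒᵖ ⋙ E₂.obj) :=
    comp_preservesFiniteLimits _ _
  exact (RightFreyd.whiskerLeft_rightOp_functor_bijective
    (RightFreyd.functor (RightFreyd Cᵒᵖ)ᵒᵖ ⋙ E₁.obj)
    (RightFreyd.functor (RightFreyd Cᵒᵖ)ᵒᵖ ⋙ E₂.obj)).comp
    (RightFreyd.whiskerLeft_functor_bijective E₁.obj E₂.obj)

end Construction

section Existence

variable (R : Type u) [Category.{v} R] [Preadditive R] [EssentiallySmall.{w} R]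

/-- Every skeletally small preadditive category has a free abelian category. -/
theorem exists_isFreeAbelian : ∃ (B : Type w) (_ : SmallCategory B) (_ : Abelian B) (j : R ⥤+ B),
    IsFreeAbelian.{w} j := by
  have : EssentiallySmall.{w} (Mat_ R) := Mat_.essentiallySmall
  let e := equivSmallModel.{w} (Mat_ R)
  let C := SmallModel.{w} (Mat_ R)
  let _ : Preadditive C := .ofFullyFaithful e.symm.fullyFaithfulFunctor
  have : e.inverse.Additive := e.symm.fullyFaithfulFunctor.additive_ofFullyFaithful
  have : e.functor.Additive := e.symm.additive_inverse_of_FullyFaithful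
  have : HasFiniteProducts C := e.functor.hasFiniteProducts_of_additive_of_essSurj
  have : HasFiniteBiproducts C := HasFiniteBiproducts.of_hasFiniteProducts
  have : HasZeroObject C := hasZeroObject_of_hasFiniteBiproducts _
  let k : R ⥤ C := Mat_.embedding R ⋙ e.functor
  have hk (M : C) : ∃ (J : Type) (_ : Fintype J) (X : J → R) (p : ∀ i, M ⟶ k.obj (X i))
      (q : ∀ i, k.obj (X i) ⟶ M), ∑ i, p i ≫ q i = 𝟙 M := by
    obtain ⟨J, _, X, p, q, h⟩ := (e.inverse.obj M).exists_sum_eq_id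
    refine ⟨J, inferInstance, X, fun i ↦ e.counitInv.app M ≫ e.functor.map (p i),
      fun i ↦ e.functor.map (q i) ≫ e.counit.app M, ?_⟩
    have h' (i) : (e.counitInv.app M ≫ e.functor.map (p i)) ≫ e.functor.map (q i) ≫
        e.counit.app M = e.counitInv.app M ≫ e.functor.map (p i ≫ q i) ≫ e.counit.app M := by
      simp
    rw [Finset.sum_congr rfl fun i _ ↦ h' i, ← Preadditive.comp_sum, ← Preadditive.sum_comp,
      ← e.functor.map_sum, h, e.functor.map_id]
    refine (congrArg _ (Category.id_comp _)).trans ?_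
    exact e.counitIso.inv_hom_id_app M
  refine ⟨FreydAbelian C, inferInstance, inferInstance, ⟨k ⋙ toFreydAbelian C,
    (inferInstance : (k ⋙ toFreydAbelian C).Additive)⟩, inferInstance,
    inferInstanceAs (k ⋙ toFreydAbelian C).Full,
    inferInstanceAs (k ⋙ toFreydAbelian C).Faithful, ?_, ?_⟩
  · intro D _ _ F
    have : F.obj.Additive := F.property
    have : HasFiniteBiproducts D := Abelian.hasFiniteBiproducts
    obtain ⟨E, ⟨i⟩⟩ := exists_exact_extension (e.inverse ⋙ Mat_.extend F.obj)
    refine ⟨E, ⟨Functor.associator _ _ _ ≪≫ Functor.isoWhiskerLeft k i ≪≫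
      Functor.associator _ _ _ ≪≫ Functor.isoWhiskerLeft (Mat_.embedding R)
        ((Functor.associator _ _ _).symm ≪≫ Functor.isoWhiskerRight e.unitIso.symm _ ≪≫
          Functor.leftUnitor _) ≪≫ Mat_.embeddingExtendIso F.obj⟩⟩
  · intro D _ _ E₁ E₂ α
    refine exists_iso_of_whiskerLeft_bijective (k ⋙ toFreydAbelian C)
      (exactFunctor (FreydAbelian C) D) (fun G H hG hH ↦ ?_) E₁.property E₂.property α
    have : G.Additive := ((AdditiveFunctor.ofExact _ D).obj ⟨G, hG⟩).property
    have : H.Additive := ((AdditiveFunctor.ofExact _ D).obj ⟨H, hH⟩).property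
    exact (whiskerLeft_bijective_of_sum_eq_id k hk (toFreydAbelian C ⋙ G)
      (toFreydAbelian C ⋙ H)).comp
      (whiskerLeft_toFreydAbelian_bijective ⟨G, hG⟩ ⟨H, hH⟩)

end Existence

end

end FreeAb

/-! ### Exact functors and change of universe. -/

namespace FreeAb

noncomputable section

section Exact

variable {B : Type u} [Category.{v} B] {A : Type u₁} [Category.{v₁} A]
  {D : Type u₂} [Category.{v₂} D]

lemma exactFunctor_comp (F : B ⥤ A) (G : A ⥤ D) (hF : exactFunctor B A F)
    (hG : exactFunctor A D G) : exactFunctor B D (F ⋙ G) := by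
  have : PreservesFiniteLimits F := hF.1
  have : PreservesFiniteColimits F := hF.2
  have : PreservesFiniteLimits G := hG.1
  have : PreservesFiniteColimits G := hG.2
  exact ⟨comp_preservesFiniteLimits _ _, comp_preservesFiniteColimits _ _⟩

lemma exactFunctor_of_isEquivalence (F : B ⥤ A) [F.IsEquivalence] : exactFunctor B A F :=
  ⟨(inferInstance : PreservesFiniteLimits F), (inferInstance : PreservesFiniteColimits F)⟩

lemma additive_of_exactFunctor [Abelian B] [Abelian A] {F : B ⥤ A} (hF : exactFunctor B A F) : F.Additive :=
  ((AdditiveFunctor.ofExact B A).obj ⟨F, hF⟩).property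

end Exact

section Models

variable (D : Type u₂) [Category.{v₂} D] [Abelian D]

/-- A category equivalent to an abelian category is abelian. -/
lemma exists_abelian_of_equivalence {D' : Type u₁} [Category.{v₁} D'] (e : D ≌ D') :
    Nonempty (Abelian D') := by
  let _ : Preadditive D' := .ofFullyFaithful e.symm.fullyFaithfulFunctor
  have : e.inverse.Additive := e.symm.fullyFaithfulFunctor.additive_ofFullyFaithful
  have : e.functor.Additive := e.symm.additive_inverse_of_FullyFaithful
  have : HasFiniteProducts D' := e.functor.hasFiniteProducts_of_additive_of_essSurj
  exact ⟨abelianOfEquivalence e.inverse⟩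

lemma exists_abelian_model [EssentiallySmall.{w} D] :
    ∃ (D' : Type (w + 1)) (_ : Category.{w} D') (_ : Abelian D'), Nonempty (D ≌ D') := by
  -- The `ULift` puts the objects in `Type (w + 1)`, as `IsFreeAbelian` demands of its targets.
  let _ : Category.{w} (ULift.{w + 1} (SmallModel.{w} D)) := uliftCategory _
  let e : D ≌ ULift.{w + 1} (SmallModel.{w} D) := (equivSmallModel D).trans ULift.equivalence
  exact ⟨_, _, (exists_abelian_of_equivalence D e).some, ⟨e⟩⟩

end Models

namespace IsFreeAbelian

variable {R : Type u} [Category.{v} R] [Preadditive R]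
  {B : Type u'} [Category.{v'} B] [Abelian B] {j : R ⥤+ B}
  {D : Type u₂} [Category.{v₂} D] [Abelian D] [EssentiallySmall.{w} D]

/-- Transport to an abelian model makes the universal property available for targets such as other
free abelian categories and Serre quotients. -/
lemma exists_extension_of_essentiallySmall (hj : IsFreeAbelian.{w} j) (F : R ⥤ D) [F.Additive] :
    ∃ E : B ⥤ₑ D, Nonempty (j.obj ⋙ E.obj ≅ F) := by
  obtain ⟨D', _, _, ⟨e⟩⟩ := exists_abelian_model.{w} D
  have : e.functor.Additive := additive_of_exactFunctor (exactFunctor_of_isEquivalence _)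
  obtain ⟨E, ⟨i⟩⟩ := hj.exists_extension D' ⟨F ⋙ e.functor, (inferInstance :
    (F ⋙ e.functor).Additive)⟩
  exact ⟨⟨E.obj ⋙ e.inverse, exactFunctor_comp _ _ E.property (exactFunctor_of_isEquivalence _)⟩,
    ⟨(Functor.associator _ _ _).symm ≪≫ Functor.isoWhiskerRight i e.inverse ≪≫
      Functor.associator _ _ _ ≪≫ Functor.isoWhiskerLeft F e.unitIso.symm ≪≫
      Functor.rightUnitor F⟩⟩

lemma nonempty_iso_of_essentiallySmall (hj : IsFreeAbelian.{w} j) {E₁ E₂ : B ⥤ D} (h₁ : exactFunctor B D E₁)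
    (h₂ : exactFunctor B D E₂) (α : j.obj ⋙ E₁ ≅ j.obj ⋙ E₂) : Nonempty (E₁ ≅ E₂) := by
  obtain ⟨D', _, _, ⟨e⟩⟩ := exists_abelian_model.{w} D
  obtain ⟨β, -⟩ := hj.extension_unique D'
    ⟨E₁ ⋙ e.functor, exactFunctor_comp _ _ h₁ (exactFunctor_of_isEquivalence _)⟩
    ⟨E₂ ⋙ e.functor, exactFunctor_comp _ _ h₂ (exactFunctor_of_isEquivalence _)⟩
    ((Functor.associator _ _ _).symm ≪≫ Functor.isoWhiskerRight α e.functor ≪≫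
      Functor.associator _ _ _)
  exact ⟨(e.congrRight (E := B)).fullyFaithfulFunctor.preimageIso β⟩

/-- Two free abelian categories on `R` are equivalent. -/
lemma exists_equivalence (hj : IsFreeAbelian.{w} j) {B' : Type u''} [Category.{v''} B'] [Abelian B']
    {j' : R ⥤+ B'} (hj' : IsFreeAbelian.{w} j') :
    ∃ e : B ≌ B', Nonempty (j.obj ⋙ e.functor ≅ j'.obj) := by
  have := hj.essentiallySmall
  have := hj'.essentiallySmall
  have : j.obj.Additive := j.property
  have : j'.obj.Additive := j'.property
  obtain ⟨E, ⟨i⟩⟩ := hj.exists_extension_of_essentiallySmall j'.obj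
  obtain ⟨E', ⟨i'⟩⟩ := hj'.exists_extension_of_essentiallySmall j.obj
  obtain ⟨η⟩ := hj.nonempty_iso_of_essentiallySmall (exactFunctor_of_isEquivalence (𝟭 B))
    (exactFunctor_comp _ _ E.property E'.property)
    (Functor.rightUnitor _ ≪≫ i'.symm ≪≫ Functor.isoWhiskerRight i.symm E'.obj ≪≫
      Functor.associator _ _ _)
  obtain ⟨ε⟩ := hj'.nonempty_iso_of_essentiallySmall
    (exactFunctor_comp _ _ E'.property E.property) (exactFunctor_of_isEquivalence (𝟭 B'))
    ((Functor.associator _ _ _).symm ≪≫ Functor.isoWhiskerRight i' E.obj ≪≫ i ≪≫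
      (Functor.rightUnitor _).symm)
  exact ⟨CategoryTheory.Equivalence.mk E.obj E'.obj η ε, ⟨i⟩⟩

end IsFreeAbelian

/-! ### Quotients by kernels of exact functors. -/

section SerreQuotient

lemma essentiallySmall_localization {C : Type u₁} [Category.{v₁} C] [EssentiallySmall.{w} C]
    (W : MorphismProperty C) [W.RespectsIso] : EssentiallySmall.{w} W.Localization := by
  let e := equivSmallModel.{w} C
  let W' := W.inverseImage e.inverse
  have : (e.inverse ⋙ W.Q).IsLocalization W' :=
    Functor.IsLocalization.of_equivalence_source W.Q W (e.inverse ⋙ W.Q) W' e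
      (fun X Y f hf ↦ W'.le_isoClosure _ ((W.arrow_mk_iso_iff
        (((Functor.mapArrowFunctor _ _).mapIso e.unitIso).app (Arrow.mk f))).1 hf))
      (fun X Y f hf ↦ Localization.inverts W.Q W _ hf)
      ((Functor.associator _ _ _).symm ≪≫ Functor.isoWhiskerRight e.unitIso.symm _ ≪≫
        Functor.leftUnitor _)
  exact EssentiallySmall.mk' (Localization.uniq (e.inverse ⋙ W.Q) W'.Q W')

variable {C : Type u₁} [Category.{v₁} C] [Abelian C] {D : Type u₂} [Category.{v₂} D] [Abelian D]

/-- An exact functor carries the kernel and cokernel of `f` to those of its image. The localising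
class is thus determined by the functor alone and can be compared along a change of source. -/
lemma isoModSerre_ker_iff (F : C ⥤ₑ D) {X Y : C} (f : X ⟶ Y) :
    (ker F).isoModSerre f ↔ IsIso (F.obj.map f) := by
  refine ⟨ker_isInvertedBy F f, fun _ ↦ ?_⟩
  have := additive_of_exactFunctor F.property
  have : PreservesFiniteLimits F.obj := F.property.1
  have : PreservesFiniteColimits F.obj := F.property.2
  exact ⟨(isZero_kernel_of_mono (F.obj.map f)).of_iso (PreservesKernel.iso F.obj f),
    (isZero_cokernel_of_epi (F.obj.map f)).of_iso (PreservesCokernel.iso F.obj f)⟩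

/-- The functor induced by `F` on the quotient by its kernel extends `F`. -/
def quotientFunctorInducedIso (F : C ⥤ₑ D) :
    (quotientFunctor (ker F)).obj ⋙ (induced F).obj ≅ F.obj :=
  Localization.fac F.obj (ker_isInvertedBy F) (ker F).isoModSerre.Q

instance (S : ObjectProperty C) [S.IsSerreClass] :
    (quotientFunctor S).obj.IsLocalization S.isoModSerre :=
  inferInstanceAs (S.isoModSerre.Q.IsLocalization _)

/-- An isomorphism of functors on `C/S` is determined by its restriction to `C`. -/
lemma nonempty_iso_of_quotientFunctor_comp {S : ObjectProperty C} [S.IsSerreClass]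
    {E : Type u₃} [Category.{v₃} E] {G H : SerreQuotient S ⥤ E}
    (i : (quotientFunctor S).obj ⋙ G ≅ (quotientFunctor S).obj ⋙ H) : Nonempty (G ≅ H) :=
  ⟨Localization.liftNatIso (quotientFunctor S).obj S.isoModSerre ((quotientFunctor S).obj ⋙ G)
    ((quotientFunctor S).obj ⋙ H) G H i⟩

/-- If `Φ` is a localization functor and `F ≅ Φ ⋙ G`, then the quotients by the kernels of `F` and `G`
are equivalent. -/
lemma exists_equivalence_serreQuotient {B : Type u} [Category.{v} B] [Abelian B]
    (Φ : B ⥤ C) (W : MorphismProperty B) [Φ.IsLocalization W] [Φ.mapArrow.EssSurj]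
    (F : B ⥤ₑ D) (G : C ⥤ₑ D) (i : Φ ⋙ G.obj ≅ F.obj) :
    ∃ θ : SerreQuotient (ker F) ≌ SerreQuotient (ker G),
      Nonempty ((quotientFunctor (ker F)).obj ⋙ θ.functor ≅ Φ ⋙ (quotientFunctor (ker G)).obj) ∧
      Nonempty (θ.functor ⋙ (induced G).obj ≅ (induced F).obj) := by
  have hF {X Y : B} (f : X ⟶ Y) : (ker F).isoModSerre f ↔ (ker G).isoModSerre (Φ.map f) := by
    rw [isoModSerre_ker_iff, isoModSerre_ker_iff]
    exact (NatIso.isIso_map_iff i f).symm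
  -- By `hF` both quotients localise `B` at the same class. A composite of localisations is one once
  -- each map inverted by the second lifts, up to isomorphism of arrows, to the class in `B`; this
  -- is where `Φ.mapArrow.EssSurj` enters.
  have : (Φ ⋙ (quotientFunctor (ker G)).obj).IsLocalization (ker F).isoModSerre := by
    refine Functor.IsLocalization.comp Φ (quotientFunctor (ker G)).obj W (ker G).isoModSerre _
      (fun X Y f hf ↦ ?_) (fun X Y f hf ↦ ?_) (fun X Y g hg ↦ ?_)
    · exact Localization.inverts (quotientFunctor (ker G)).obj _ _ ((hF f).1 hf)
    · have := Localization.inverts Φ W f hf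
      exact (hF f).2 ((ker G).isoModSerre_of_isIso _)
    · let e := Φ.mapArrow.objObjPreimageIso (Arrow.mk g)
      exact ⟨_, _, (Φ.mapArrow.objPreimage (Arrow.mk g)).hom, (hF _).2
        (((ker G).isoModSerre.arrow_mk_iso_iff e).2 hg), ⟨e⟩⟩
  let θ := Localization.uniq (quotientFunctor (ker F)).obj (Φ ⋙ (quotientFunctor (ker G)).obj)
    (ker F).isoModSerre
  let k : (quotientFunctor (ker F)).obj ⋙ θ.functor ≅ Φ ⋙ (quotientFunctor (ker G)).obj :=
    Localization.compUniqFunctor _ _ _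
  refine ⟨θ, ⟨k⟩, nonempty_iso_of_quotientFunctor_comp ?_⟩
  exact (Functor.associator _ _ _).symm ≪≫ Functor.isoWhiskerRight k _ ≪≫
    Functor.associator _ _ _ ≪≫ Functor.isoWhiskerLeft Φ (quotientFunctorInducedIso G) ≪≫ i ≪≫
    (quotientFunctorInducedIso F).symm

end SerreQuotient

/-! ### Every abelian category is a quotient of a free one. -/

section Presentation

variable {A : Type u₁} [Category.{v₁} A] [Abelian A] {B : Type u} [Category.{v} B] [Abelian B]

/-- Every object of the quotient comes from `B`, and an object of `B` becomes zero there precisely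
when `E` kills it. -/
lemma isZero_of_isZero_induced (E : B ⥤ₑ A) (X : SerreQuotient (ker E))
    (hX : IsZero ((induced E).obj.obj X)) : IsZero X := by
  have : (quotientFunctor (ker E)).obj.EssSurj :=
    Localization.essSurj (quotientFunctor (ker E)).obj (ker E).isoModSerre
  let e := (quotientFunctor (ker E)).obj.objObjPreimageIso X
  have : (quotientFunctor (ker E)).obj.Additive :=
    additive_of_exactFunctor (quotientFunctor (ker E)).property
  refine IsZero.of_iso ?_ e.symm
  rw [ObjectProperty.SerreClassLocalization.isZero_obj_iff (quotientFunctor (ker E)).obj (ker E)]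
  exact hX.of_iso ((quotientFunctorInducedIso E).symm.app _ ≪≫ (induced E).obj.mapIso e)

/-- A functor whose composition with the faithful exact functor induced by `E` is exact is
exact. -/
lemma exactFunctor_of_comp_induced {C : Type u₂} [Category.{v₂} C] [Abelian C] (E : B ⥤ₑ A)
    (Ψ : C ⥤ SerreQuotient (ker E)) [Ψ.Additive]
    (h : exactFunctor C A (Ψ ⋙ (induced E).obj)) : exactFunctor C _ Ψ := by
  have := additive_of_exactFunctor (induced E).property
  have : PreservesFiniteLimits (induced E).obj := (induced E).property.1
  have : PreservesFiniteColimits (induced E).obj := (induced E).property.2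
  have h' := ((Ψ ⋙ (induced E).obj).exact_tfae.out 1 3).2 h
  refine (Ψ.exact_tfae.out 1 3).1 fun S hS ↦ ?_
  have hS' := h' S hS
  -- The induced functor commutes with homology and detects its vanishing.
  rw [ShortComplex.exact_iff_isZero_homology] at hS' ⊢
  exact isZero_of_isZero_induced E _
    (hS'.of_iso ((S.map Ψ).mapHomologyIso (induced E).obj).symm)

/-- An abelian category is the quotient, by the kernel of the counit, of the free abelian category
on its underlying preadditive category. -/
lemma nonempty_serreQuotient_equivalence [EssentiallySmall.{w} A] (j : A ⥤+ B)
    (hj : IsFreeAbelian.{w} j) (E : B ⥤ₑ A) (i : j.obj ⋙ E.obj ≅ 𝟭 A) :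
    Nonempty (SerreQuotient (ker E) ≌ A) := by
  have := hj.essentiallySmall
  have : EssentiallySmall.{w} (SerreQuotient (ker E)) := essentiallySmall_localization _
  let Q := quotientFunctor (ker E)
  have : j.obj.Additive := j.property
  have : Q.obj.Additive := additive_of_exactFunctor Q.property
  let ε : (j.obj ⋙ Q.obj) ⋙ (induced E).obj ≅ 𝟭 A :=
    Functor.associator _ _ _ ≪≫ Functor.isoWhiskerLeft _ (quotientFunctorInducedIso E) ≪≫ i
  -- `j` itself need not be exact, but `j` followed by the quotient is, since applying the induced
  -- functor gives the identity.
  have hΨ : exactFunctor A _ (j.obj ⋙ Q.obj) := exactFunctor_of_comp_induced E _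
    (ObjectProperty.prop_of_iso _ ε.symm (exactFunctor_of_isEquivalence (𝟭 A)))
  -- `Q` and `E ⋙ j ⋙ Q` are exact and agree on `A`, because `j ⋙ E` is the identity.
  obtain ⟨β⟩ := hj.nonempty_iso_of_essentiallySmall Q.property
    (exactFunctor_comp _ _ E.property hΨ) ((Functor.leftUnitor _).symm ≪≫
      Functor.isoWhiskerRight i.symm _ ≪≫ Functor.associator _ _ _)
  obtain ⟨η⟩ : Nonempty (𝟭 (SerreQuotient (ker E)) ≅ (induced E).obj ⋙ j.obj ⋙ Q.obj) :=
    nonempty_iso_of_quotientFunctor_comp (Functor.rightUnitor _ ≪≫ β ≪≫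
      Functor.isoWhiskerRight (quotientFunctorInducedIso E).symm _ ≪≫ Functor.associator _ _ _)
  exact ⟨CategoryTheory.Equivalence.mk _ _ η ε⟩

end Presentation

end

end FreeAb

theorem mainTheorem2 :
    -- every skeletally small preadditive category has a free abelian category
    (∀ (R : Type u) [Category.{v} R] [Preadditive R] [EssentiallySmall.{w} R],
      ∃ (B : Type w) (_ : SmallCategory B) (_ : Abelian B) (j : R ⥤+ B),
        FreeAb.IsFreeAbelian.{w} j) ∧
    -- from modules `M : R ⥤+ Ab` to exact functors `A(M) ⥤ₑ Ab`
    (∀ (R : Type u) [Category.{v} R] [Preadditive R] [EssentiallySmall.{w} R]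
      (B : Type u') [Category.{v'} B] [Abelian B] (j : R ⥤+ B)
      (_ : FreeAb.IsFreeAbelian.{w} j) (M : R ⥤+ AddCommGrpCat.{w}),
      -- the exact extension of `M` to the free abelian category exists and is unique
      (∃ Mt : B ⥤ₑ AddCommGrpCat.{w}, Nonempty (j.obj ⋙ Mt.obj ≅ M.obj)) ∧
      (∀ Mt Mt' : B ⥤ₑ AddCommGrpCat.{w}, Nonempty (j.obj ⋙ Mt.obj ≅ M.obj) →
        Nonempty (j.obj ⋙ Mt'.obj ≅ M.obj) → Nonempty (Mt ≅ Mt')) ∧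
      ∀ Mt : B ⥤ₑ AddCommGrpCat.{w}, Nonempty (j.obj ⋙ Mt.obj ≅ M.obj) →
        -- `A(M)` is skeletally small, and the extension factors uniquely through an exact
        -- functor on `A(M)`
        EssentiallySmall.{w} (FreeAb.SerreQuotient (FreeAb.ker Mt)) ∧
        Nonempty ((FreeAb.quotientFunctor (FreeAb.ker Mt)).obj ⋙ (FreeAb.induced Mt).obj ≅
          Mt.obj) ∧
        (∀ H : FreeAb.SerreQuotient (FreeAb.ker Mt) ⥤ₑ AddCommGrpCat.{w},
          Nonempty ((FreeAb.quotientFunctor (FreeAb.ker Mt)).obj ⋙ H.obj ≅ Mt.obj) →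
          Nonempty (H ≅ FreeAb.induced Mt)) ∧
        -- the result does not depend on the choices
        ∀ (B' : Type u'') [Category.{v''} B'] [Abelian B'] (j' : R ⥤+ B')
          (_ : FreeAb.IsFreeAbelian.{w} j') (Mt' : B' ⥤ₑ AddCommGrpCat.{w}),
          Nonempty (j'.obj ⋙ Mt'.obj ≅ M.obj) →
          ∃ φ : FreeAb.SerreQuotient (FreeAb.ker Mt) ≌ FreeAb.SerreQuotient (FreeAb.ker Mt'),
            Nonempty (φ.functor ⋙ (FreeAb.induced Mt').obj ≅ (FreeAb.induced Mt).obj)) ∧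
    -- from exact functors `G : A ⥤ₑ Ab` to modules, and back
    (∀ (A : Type u₁) [Category.{v₁} A] [Abelian A] [EssentiallySmall.{w} A],
      -- `A` is a Serre quotient of a free abelian category
      (∃ (R : Type w) (_ : SmallCategory R) (_ : Preadditive R)
        (B : Type w) (_ : SmallCategory B) (_ : Abelian B) (j : R ⥤+ B)
        (_ : FreeAb.IsFreeAbelian.{w} j) (S : ObjectProperty B) (_ : S.IsSerreClass),
        Nonempty (FreeAb.SerreQuotient S ≌ A)) ∧
      ∀ (G : A ⥤ₑ AddCommGrpCat.{w})
        (R : Type u) [Category.{v} R] [Preadditive R] [EssentiallySmall.{w} R]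
        (B : Type u') [Category.{v'} B] [Abelian B] (j : R ⥤+ B)
        (_ : FreeAb.IsFreeAbelian.{w} j) (S : ObjectProperty B) [S.IsSerreClass]
        (e : FreeAb.SerreQuotient S ≌ A) (M : R ⥤+ AddCommGrpCat.{w}),
        -- for the module `M` which is the restriction of `G` along `R ⥤ B ⥤ B/S ≌ A`
        Nonempty (M ≅ FreeAb.restrict j (FreeAb.composite e G)) →
        ∀ Mt : B ⥤ₑ AddCommGrpCat.{w}, Nonempty (j.obj ⋙ Mt.obj ≅ M.obj) →
          ∃ θ : FreeAb.SerreQuotient (FreeAb.ker Mt) ≌ FreeAb.SerreQuotient (FreeAb.ker G),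
            Nonempty ((FreeAb.quotientFunctor (FreeAb.ker Mt)).obj ⋙ θ.functor ≅
              (FreeAb.quotientFunctor S).obj ⋙ e.functor ⋙
                (FreeAb.quotientFunctor (FreeAb.ker G)).obj) ∧
            Nonempty (θ.functor ⋙ (FreeAb.induced G).obj ≅ (FreeAb.induced Mt).obj)) := by
  refine ⟨fun R _ _ _ ↦ FreeAb.exists_isFreeAbelian.{w} R, ?_, ?_⟩
  · intro R _ _ _ B _ _ j hj M
    have := hj.essentiallySmall
    have iso : ∀ Mt Mt' : B ⥤ₑ AddCommGrpCat.{w}, Nonempty (j.obj ⋙ Mt.obj ≅ M.obj) →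
        Nonempty (j.obj ⋙ Mt'.obj ≅ M.obj) → Nonempty (Mt ≅ Mt') := by
      rintro Mt Mt' ⟨i⟩ ⟨i'⟩
      obtain ⟨β, -⟩ := hj.extension_unique _ Mt Mt' (i ≪≫ i'.symm)
      exact ⟨ObjectProperty.isoMk _ β⟩
    refine ⟨hj.exists_extension _ M, iso, fun Mt ⟨i⟩ ↦ ⟨FreeAb.essentiallySmall_localization _,
      ⟨FreeAb.quotientFunctorInducedIso Mt⟩, ?_, ?_⟩⟩
    · rintro H ⟨k⟩
      obtain ⟨β⟩ := FreeAb.nonempty_iso_of_quotientFunctor_comp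
        (k ≪≫ (FreeAb.quotientFunctorInducedIso Mt).symm)
      exact ⟨ObjectProperty.isoMk _ β⟩
    · rintro B' _ _ j' hj' Mt' ⟨i'⟩
      obtain ⟨e, ⟨k⟩⟩ := hj.exists_equivalence hj'
      obtain ⟨β⟩ := iso ⟨e.functor ⋙ Mt'.obj, FreeAb.exactFunctor_comp _ _
        (FreeAb.exactFunctor_of_isEquivalence _) Mt'.property⟩ Mt
        ⟨(Functor.associator _ _ _).symm ≪≫ Functor.isoWhiskerRight k _ ≪≫ i'⟩ ⟨i⟩
      -- An equivalence localises at isomorphisms, so the comparison of quotients applies to it.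
      have : e.functor.IsLocalization (MorphismProperty.isomorphisms B) :=
        Functor.IsLocalization.of_isEquivalence _ _ le_rfl
      obtain ⟨θ, -, h⟩ := FreeAb.exists_equivalence_serreQuotient e.functor
        (MorphismProperty.isomorphisms B) Mt Mt' ((ObjectProperty.ι _).mapIso β)
      exact ⟨θ, h⟩
  · intro A _ _ _
    constructor
    · let R := SmallModel.{w} A
      let _ : Abelian R := (FreeAb.exists_abelian_of_equivalence A (equivSmallModel.{w} A)).some
      obtain ⟨B, _, _, j, hj⟩ := FreeAb.exists_isFreeAbelian.{w} R
      obtain ⟨E, ⟨i⟩⟩ := hj.exists_extension_of_essentiallySmall (𝟭 R)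
      obtain ⟨e⟩ := FreeAb.nonempty_serreQuotient_equivalence j hj E i
      exact ⟨R, inferInstance, inferInstance, B, inferInstance, inferInstance, j, hj, FreeAb.ker E,
        inferInstance, ⟨e.trans (equivSmallModel.{w} A).symm⟩⟩
    · rintro G R _ _ _ B _ _ j hj S _ e M ⟨m⟩ Mt ⟨i⟩
      have : ((FreeAb.quotientFunctor S).obj ⋙ e.functor).IsLocalization S.isoModSerre :=
        Functor.IsLocalization.of_equivalence_target (FreeAb.quotientFunctor S).obj _ _ e
          (Iso.refl _)
      have : ((FreeAb.quotientFunctor S).obj ⋙ e.functor).mapArrow.EssSurj :=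
        Localization.essSurj_mapArrow _ S.isoModSerre
      -- Both are exact extensions of `M`, so `Mt` factors up to isomorphism through the
      -- localisation functor from `B` to `A` followed by `G`.
      obtain ⟨β, -⟩ := hj.extension_unique _ (FreeAb.composite e G) Mt
        ((ObjectProperty.ι _).mapIso m.symm ≪≫ i.symm)
      obtain ⟨θ, ⟨k⟩, h⟩ := FreeAb.exists_equivalence_serreQuotient
        ((FreeAb.quotientFunctor S).obj ⋙ e.functor) S.isoModSerre Mt G
        (Functor.associator _ _ _ ≪≫ β)
      exact ⟨θ, ⟨k ≪≫ Functor.associator _ _ _⟩, h⟩
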